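/- For a graph $G$ with vertex set $V$, let $$h(G) := \inf\Big\{ \frac{e(X, V\setminus X)}{|X|} : X\subseteq V \text{ finite and nonempty}\Big\}$$ be its edge Cheeger constant, where $e(X,V\setminus X)$ is the number of edges with exactly one endpoint in $X$. For an integer $\Delta\ge 0$, a $\Delta$-ary tree is a tree with a root in which every vertex has exactly $\Delta$ children (so the root has degree $\Delta$ and every other vertex has degree $\Delta+1$). A pseudoforest is a graph in which every connected component contains at most one cycle. A $\Delta$-ary pseudoforest is a pseudoforest in which every acyclic component is a $\Delta$-ary tree and every other component is $(\Delta+1)$-regular. **Theorem.** There is an absolute constant $\varepsilon>0$ such that the following holds for all integers $d,\Delta\ge 0$ with $\Delta<\varepsilon d$. Let $G$ be a (finite or infinite) countable simple $d$-regular graph with $$h(G) > d-3+\frac{1}{10^7\Delta+1}.$$ Then $G$ has a spanning subgraph $F$ such that 1. $F$ is a $\Delta$-ary pseudoforest; 2. each connected component of $F$ is an induced subgraph of $G$; 3. there is a set $S\subseteq V(G)$ containing exactly one vertex of each connected component of $F$ such that $F-S$ is acyclic and is an induced subgraph of $G$ (that is, $F-S=G[V(G)\setminus S]$). -/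

import Mathlib

open scoped ENNReal

namespace SimpleGraph

variable {V : Type*}

/-- The set of edges of `G` with exactly one endpoint in `X`. -/
def edgeBoundary (G : SimpleGraph V) (X : Set V) : Set (Sym2 V) :=
  {e | ∃ x ∈ X, ∃ y ∉ X, G.Adj x y ∧ e = s(x, y)}

/-- The edge Cheeger constant: the infimum of `e(X, V \ X) / |X|` over the nonempty finite
vertex sets `X`. -/
noncomputable def edgeCheeger (G : SimpleGraph V) : ℝ≥0∞ :=
  ⨅ X : Finset V, ⨅ _ : X.Nonempty, ((G.edgeBoundary (X : Set V)).encard : ℝ≥0∞) / (X.card : ℝ≥0∞)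

/-- A pseudoforest: every connected component contains at most one cycle (as a subgraph). -/
def IsPseudoforest (F : SimpleGraph V) : Prop :=
  ∀ (u v : V) (p : F.Walk u u) (q : F.Walk v v), F.Reachable u v →
    p.IsCycle → q.IsCycle → p.toSubgraph = q.toSubgraph

/-- A `k`-ary tree: a tree with a root such that every vertex has exactly `k` children. That is,
the root has degree `k` and every other vertex (having one parent) has degree `k + 1`. -/
def IsAryTree (k : ℕ) (T : SimpleGraph V) : Prop :=
  T.IsTree ∧ ∃ r : V, (T.neighborSet r).encard = (k : ℕ∞) ∧
    ∀ v : V, v ≠ r → (T.neighborSet v).encard = ((k + 1 : ℕ) : ℕ∞)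

/-- A `k`-ary pseudoforest: a pseudoforest whose acyclic components are `k`-ary trees and whose
other components are `(k + 1)`-regular. -/
def IsAryPseudoforest (k : ℕ) (F : SimpleGraph V) : Prop :=
  F.IsPseudoforest ∧ ∀ c : F.ConnectedComponent,
    (c.toSimpleGraph.IsAcyclic → IsAryTree k c.toSimpleGraph) ∧
    (¬ c.toSimpleGraph.IsAcyclic →
      ∀ v : c, (c.toSimpleGraph.neighborSet v).encard = ((k + 1 : ℕ) : ℕ∞))

/-- The spanning subgraph `F` of `G` is component-wise induced: the vertex set of each component
of `F` induces in `G` exactly that component. -/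
def IsComponentwiseInduced (F G : SimpleGraph V) : Prop :=
  ∀ c : F.ConnectedComponent, F.induce c.supp = G.induce c.supp

/-- `S` contains exactly one vertex of each connected component of `F`. -/
def IsComponentTransversal (F : SimpleGraph V) (S : Set V) : Prop :=
  ∀ c : F.ConnectedComponent, ∃! v : V, v ∈ S ∧ v ∈ c.supp

end SimpleGraph

/-!
Write `h(G)` for the edge Cheeger constant. In a `d`-regular graph, `h(G) > d - 3` implies that every
finite vertex set `X` spans at most `3|X|/2` edges. Give each edge two tokens. By Hall's theorem the
tokens can be handed to endpoints of their edges so that no vertex receives more than three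
(`exists_half_orientation`). If both tokens of an edge `vw` go to `v`, call `w` the parent of `v`;
if the tokens are split, call the edge balanced. Then every vertex has at most one parent, is in
at most three balanced edges, is in at most one balanced edge if it has a parent, and has at least
`d - 3` children (`exists_parentDecomposition`). With `p v` the parent of `v`, or `v` itself if there
is none, the forest is obtained by choosing a set `T` of vertices and keeping the edges from `t` to
`p t` for `t ∈ T`; the complement `S` of `T` is the set of roots. It remains to choose `T` so that
every vertex has exactly `Δ` children in `T`, the forest has no infinite ascending path, no balanced
edge joins two vertices of `T`, and no edge of `G` outside the forest joins a root to its own tree.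

* Balanced edges inside `T`. Each vertex has at least `2(Δ + 4)` children, and a balanced edge
  concerns at most two parents. Hence Hall's theorem yields sets of `Δ + 4` children of each vertex
  such that no balanced edge has both endpoints in these sets
  (`IsParentDecomposition.exists_independent_children`). `T` is taken inside their union.
* Ascending paths. There is a set `B`, disjoint from `T` by construction, that meets every orbit of
  `p`, contains all cycles of `p`, and contains at most one child of each vertex
  (`Function.exists_backbone`). An edge from a root to its parent inside its own tree would close a
  cycle of `p`, so it does not exist.
* Balanced edges from a root `s` to its tree. The distance to `B` along `p` decreases along parents,
  so the root of the tree of `v` may be taken as known when the children of `v` are selected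
  (`exists_root_of_attachment`). Each vertex of the tree of `s` discards the at most three children
  that a balanced edge joins to `s`.

Of `Δ + 4` children at most `1 + 3` are discarded, so `Δ` can be selected everywhere
(`IsParentDecomposition.exists_aryPseudoforest`). All components obtained are trees. For `Δ = 0` the
graph without edges has the required properties.
-/

namespace SimpleGraph

open Finset Function

/-! ### Sparsity and the distribution of edge tokens -/

/-- In a `d`-regular graph with edge Cheeger constant above `d - 3`, every finite set of vertices
spans at most `3/2` times as many edges. -/
theorem two_mul_card_le_three_mul_card {V : Type*} (G : SimpleGraph V) [G.LocallyFinite] {d : ℕ}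
    (hd : G.IsRegularOfDegree d) (hh : (((d : ℝ) - 3 : ℝ) : EReal) < (G.edgeCheeger : EReal))
    (A : Finset (Sym2 V)) (hA : ∀ e ∈ A, e ∈ G.edgeSet) (X : Finset V)
    (hX : ∀ e ∈ A, ∀ v ∈ e, v ∈ X) : 2 * #A ≤ 3 * #X := by
  classical
  rcases X.eq_empty_or_nonempty with rfl | hne
  · have : A = ∅ := by
      refine Finset.eq_empty_of_forall_notMem fun e he => ?_
      induction e with
      | _ a b => exact absurd (hX _ he a (Sym2.mem_mk_left a b)) (by simp)
    simp [this]
  set D : Finset (Σ _ : V, V) := X.sigma fun v => G.neighborFinset v with hD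
  have hDcard : #D = d * #X := by
    rw [hD, Finset.card_sigma, Finset.sum_congr rfl (fun v _ => ?_), Finset.sum_const, smul_eq_mul,
      mul_comm]
    rw [card_neighborFinset_eq_degree, hd.degree_eq]
  have hsplit := Finset.card_filter_add_card_filter_not (s := D) (fun x => x.2 ∈ X)
  -- Each edge of `A` gives two darts inside `X`.
  have hin : 2 * #A ≤ #(D.filter fun x => x.2 ∈ X) := by
    have h := Finset.card_mul_le_card_mul (s := A) (t := D.filter fun x => x.2 ∈ X)
      (fun e x => s(x.1, x.2) = e) (m := 2) (n := 1) (fun e he => ?_) (fun x _ => ?_)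
    · linarith
    · induction e with
      | _ a b =>
        have hab : G.Adj a b := hA _ he
        have ha := hX _ he a (Sym2.mem_mk_left a b)
        have hb := hX _ he b (Sym2.mem_mk_right a b)
        have hsub : ({⟨a, b⟩, ⟨b, a⟩} : Finset (Σ _ : V, V)) ⊆
            bipartiteAbove (fun e x => s(x.1, x.2) = e) (D.filter fun x => x.2 ∈ X) s(a, b) := by
          intro x hx
          simp only [Finset.mem_insert, Finset.mem_singleton] at hx
          rcases hx with rfl | rfl
          · simp [bipartiteAbove, hD, ha, hb, hab]
          · simp [bipartiteAbove, hD, ha, hb, hab.symm]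
        refine le_trans (le_of_eq ?_) (Finset.card_le_card hsub)
        rw [Finset.card_pair]
        intro h
        simp only [Sigma.mk.injEq] at h
        exact hab.ne h.1
    · refine Finset.card_le_one.2 fun e he e' he' => ?_
      rw [mem_bipartiteBelow] at he he'
      exact he.2.symm.trans he'.2
  set b := #(D.filter fun x => ¬ x.2 ∈ X) with hb
  have hbd : (G.edgeBoundary (X : Set V)).encard ≤ (b : ℕ∞) := by
    have hsub : G.edgeBoundary (X : Set V) ⊆
        (((D.filter fun x => ¬ x.2 ∈ X).image fun x => s(x.1, x.2) : Finset (Sym2 V)) :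
          Set (Sym2 V)) := by
      rintro e ⟨x, hx, y, hy, hxy, rfl⟩
      simp only [Finset.coe_image, Set.mem_image]
      exact ⟨⟨x, y⟩, by simpa [hD, hxy] using ⟨hx, hy⟩, rfl⟩
    refine (Set.encard_le_encard hsub).trans ?_
    rw [Set.encard_coe_eq_coe_finsetCard]
    exact_mod_cast Finset.card_image_le
  have hpos : (0 : ℝ) < #X := by exact_mod_cast hne.card_pos
  have hle : G.edgeCheeger ≤ ENNReal.ofReal ((b : ℝ) / #X) := by
    refine (iInf₂_le X hne).trans ?_
    rw [ENNReal.ofReal_div_of_pos hpos, ENNReal.ofReal_natCast, ENNReal.ofReal_natCast]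
    gcongr
    exact_mod_cast hbd
  have hlt : (d : ℝ) - 3 < (b : ℝ) / #X := by
    have h := hh.trans_le (EReal.coe_ennreal_le_coe_ennreal_iff.2 hle)
    rw [EReal.coe_ennreal_ofReal, max_eq_left (by positivity)] at h
    exact_mod_cast h
  rw [lt_div_iff₀ hpos] at hlt
  have h1 : (2 * #A + b : ℝ) ≤ d * #X := by
    exact_mod_cast (by omega : 2 * #A + b ≤ d * #X)
  have h2 : (2 * #A : ℝ) ≤ 3 * #X := by nlinarith
  exact_mod_cast h2

/-- Each edge carries two tokens; `t v w` is the number of tokens of the edge `vw` that are handed to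
`v`. If every finite vertex set spans at most `3/2` times as many edges, then Hall's theorem, applied
to tokens and to three slots at each vertex, gives a distribution in which no vertex receives more
than three tokens. -/
theorem exists_half_orientation {V : Type*} (G : SimpleGraph V) [G.LocallyFinite]
    (hG : ∀ (A : Finset (Sym2 V)), (∀ e ∈ A, e ∈ G.edgeSet) → ∀ X : Finset V,
      (∀ e ∈ A, ∀ v ∈ e, v ∈ X) → 2 * #A ≤ 3 * #X) :
    ∃ t : V → V → ℕ, (∀ v w, G.Adj v w → t v w + t w v = 2) ∧
      ∀ v, ∑ w ∈ G.neighborFinset v, t v w ≤ 3 := by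
  classical
  obtain ⟨f, hf, hmem⟩ := (Finset.all_card_le_biUnion_card_iff_exists_injective
    (fun x : G.edgeSet × Fin 2 => x.1.1.toFinset ×ˢ (univ : Finset (Fin 3)))).1 (by
      intro s
      set A : Finset (Sym2 V) := s.image fun x => x.1.1 with hA
      set X : Finset V := A.biUnion fun e => e.toFinset with hX
      have h1 : #s ≤ 2 * #A := by
        have hsub : s.image (fun x => (x.1.1, x.2)) ⊆ A ×ˢ (univ : Finset (Fin 2)) := by
          intro y hy
          obtain ⟨x, hx, rfl⟩ := Finset.mem_image.1 hy
          exact Finset.mem_product.2 ⟨Finset.mem_image_of_mem _ hx, Finset.mem_univ _⟩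
        have := Finset.card_le_card hsub
        rw [Finset.card_image_of_injective, Finset.card_product, Finset.card_univ,
          Fintype.card_fin] at this
        · omega
        · rintro ⟨⟨a, ha⟩, i⟩ ⟨⟨b, hb⟩, j⟩ h
          simpa using h
      have h2 := hG A (by
        intro e he
        obtain ⟨x, -, rfl⟩ := Finset.mem_image.1 he
        exact x.1.2) X (by
        intro e he v hv
        exact Finset.mem_biUnion.2 ⟨e, he, by simpa using hv⟩)
      have h3 : X ×ˢ (univ : Finset (Fin 3)) ⊆
          s.biUnion fun x => x.1.1.toFinset ×ˢ (univ : Finset (Fin 3)) := by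
        rintro ⟨v, i⟩ hv
        simp only [hX, hA, Finset.mem_product, Finset.mem_biUnion, Finset.mem_image] at hv ⊢
        obtain ⟨⟨e, ⟨x, hx, rfl⟩, hv⟩, -⟩ := hv
        exact ⟨x, hx, hv, Finset.mem_univ _⟩
      have h4 := Finset.card_le_card h3
      rw [Finset.card_product, Finset.card_univ, Fintype.card_fin] at h4
      omega)
  set g : V → V → Finset (Fin 2) := fun v w =>
    univ.filter fun i => ∃ h : s(v, w) ∈ G.edgeSet, (f (⟨s(v, w), h⟩, i)).1 = v with hg
  refine ⟨fun v w => #(g v w), fun v w hvw => ?_, fun v => ?_⟩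
  · have he : s(v, w) ∈ G.edgeSet := hvw
    have hdisj : Disjoint (g v w) (g w v) := by
      rw [Finset.disjoint_left]
      intro i hi hi'
      simp only [hg, Finset.mem_filter, Finset.mem_univ, true_and, Sym2.eq_swap (a := w)] at hi hi'
      obtain ⟨h, h1⟩ := hi
      obtain ⟨h', h2⟩ := hi'
      exact hvw.ne (h1.symm.trans h2)
    rw [← Finset.card_union_of_disjoint hdisj]
    have : g v w ∪ g w v = univ := by
      refine Finset.eq_univ_of_forall fun i => ?_
      have hm := (Finset.mem_product.1 (hmem (⟨s(v, w), he⟩, i))).1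
      simp only [Sym2.mem_toFinset, Sym2.mem_iff] at hm
      simp only [hg, Finset.mem_union, Finset.mem_filter, Finset.mem_univ, true_and,
        Sym2.eq_swap (a := w)]
      exact hm.imp (fun h => ⟨he, h⟩) (fun h => ⟨he, h⟩)
    simp [this]
  · rw [← Finset.card_sigma]
    have hφ : ∀ x ∈ (G.neighborFinset v).sigma fun w => g v w, s(v, x.1) ∈ G.edgeSet := by
      intro x hx
      simpa using (Finset.mem_sigma.1 hx).1
    have key := Finset.card_le_card_of_injOn (s := (G.neighborFinset v).sigma fun w => g v w)
      (t := (univ : Finset (Fin 3)))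
      (fun x => if h : s(v, x.1) ∈ G.edgeSet then (f (⟨s(v, x.1), h⟩, x.2)).2 else 0)
      (fun _ _ => Finset.mem_coe.2 (Finset.mem_univ _)) (by
        rintro ⟨w, i⟩ hx ⟨w', j⟩ hy hxy
        have h1 := hφ _ hx
        have h2 := hφ _ hy
        simp only at h1 h2
        simp only [h1, h2, dite_true] at hxy
        simp only [Finset.coe_sigma, Set.mem_sigma_iff, Finset.mem_coe, hg, Finset.mem_filter,
          Finset.mem_univ, true_and] at hx hy
        obtain ⟨-, _, hx⟩ := hx
        obtain ⟨-, _, hy⟩ := hy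
        have := hf (Prod.ext (hx.trans hy.symm) hxy)
        simp only [Prod.mk.injEq, Subtype.mk.injEq, Sym2.congr_right] at this
        obtain ⟨rfl, rfl⟩ := this
        rfl)
    simpa using key

end SimpleGraph

/-! ### Functional graphs -/

/-- Every self-map `p` has a set `B` that meets every orbit, contains every cycle, and on which `p` is
injective: in each component of the functional graph take the orbit of one vertex, which lies on the
cycle if there is one. -/
theorem Function.exists_backbone {V : Type*} (p : V → V) :
    ∃ B : Set V, Set.InjOn p B ∧ (∀ v, ∃ n, p^[n] v ∈ B) ∧
      ∀ v ∈ Function.periodicPts p, v ∈ B := by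
  classical
  let r : Setoid V :=
    { r := fun v w => ∃ m n, p^[m] v = p^[n] w
      iseqv := ⟨fun v => ⟨0, 0, rfl⟩, fun ⟨m, n, h⟩ => ⟨n, m, h.symm⟩, by
        rintro u v w ⟨m, n, h⟩ ⟨m', n', h'⟩
        refine ⟨m' + m, n + n', ?_⟩
        rw [Function.iterate_add_apply, h, ← Function.iterate_add_apply, add_comm,
          Function.iterate_add_apply, h', ← Function.iterate_add_apply]⟩ }
  have hrep : ∀ c : Quotient r, ∃ x : V, Quotient.mk r x = c ∧
      ((∃ y ∈ Function.periodicPts p, Quotient.mk r y = c) → x ∈ Function.periodicPts p) := by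
    intro c
    by_cases h : ∃ y ∈ Function.periodicPts p, Quotient.mk r y = c
    · obtain ⟨y, hy, hc⟩ := h
      exact ⟨y, hc, fun _ => hy⟩
    · obtain ⟨x, hx⟩ := Quotient.exists_rep c
      exact ⟨x, hx, fun h' => absurd h' h⟩
  choose x hx hper using hrep
  have hrel : ∀ (v : V) (n : ℕ), Quotient.mk r (p^[n] v) = Quotient.mk r v := fun v n =>
    Quotient.sound ⟨0, n, rfl⟩
  refine ⟨{v | ∃ c n, p^[n] (x c) = v}, ?_, fun v => ?_, fun v hv => ?_⟩
  · rintro _ ⟨c, n, rfl⟩ _ ⟨c', n', rfl⟩ h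
    simp only [← Function.iterate_succ_apply'] at h
    obtain rfl : c = c' := by
      rw [← hx c, ← hx c', ← hrel (x c) (n + 1), h, hrel]
    by_cases hp : x c ∈ Function.periodicPts p
    · have hb := (Function.bijOn_periodicPts p).injOn
      have hmem : ∀ k, p^[k] (x c) ∈ Function.periodicPts p := fun k => by
        induction k with
        | zero => exact hp
        | succ k ih =>
          rw [Function.iterate_succ_apply']
          exact (Function.bijOn_periodicPts p).mapsTo ih
      simp only [Function.iterate_succ_apply'] at h
      exact hb (hmem n) (hmem n') h
    -- Without a periodic point in its class, the orbit of `x c` never repeats.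
    · have aux : ∀ a b, a < b → p^[a] (x c) ≠ p^[b] (x c) := by
        intro a b hab hEq
        refine hp (hper c ⟨p^[a] (x c), ⟨b - a, by omega, ?_⟩, ?_⟩)
        · rw [Function.IsPeriodicPt, Function.IsFixedPt, ← Function.iterate_add_apply,
            Nat.sub_add_cancel hab.le, hEq]
        · rw [hrel, hx]
      rcases lt_trichotomy n n' with hlt | rfl | hlt
      · exact absurd h (aux _ _ (by omega))
      · rfl
      · exact absurd h.symm (aux _ _ (by omega))
  · obtain ⟨m, n, h⟩ := Quotient.exact (hx (Quotient.mk r v))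
    exact ⟨n, _, m, h⟩
  · obtain ⟨m, n, h⟩ := Quotient.exact (hx (Quotient.mk r v))
    obtain ⟨k, hk, hfix⟩ := hv
    -- `n` steps lead from `v` into the orbit, and `n * k - n` more steps lead back to `v`.
    refine ⟨Quotient.mk r v, (n * k - n) + m, ?_⟩
    have hle : n ≤ n * k := Nat.le_mul_of_pos_right n hk
    rw [Function.iterate_add_apply, h, ← Function.iterate_add_apply, Nat.sub_add_cancel hle]
    exact (hfix.const_mul n)

namespace SimpleGraph

open Finset Function

/-! ### Forests given by a parent map -/

/-- The graph joining each vertex `v` of `T` to its parent `p v`. The values of `p` outside `T` play no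
role. -/
def parentGraph {V : Type*} (p : V → V) (T : Set V) : SimpleGraph V :=
  fromRel fun v w => v ∈ T ∧ p v = w

/-- The vertices of `T` with their parents under `p` form a rooted forest whose roots are the vertices
outside `T`, and `root v` is the root of the tree of `v`. The function `rank` decreases from a vertex
to its parent, which excludes cycles and infinite ascending paths. -/
structure IsParentForest {V : Type*} (p : V → V) (T : Set V) (root : V → V) (rank : V → ℕ) :
    Prop where
  rank_lt : ∀ v ∈ T, rank (p v) < rank v
  root_of_mem : ∀ v ∈ T, root v = root (p v)
  root_of_notMem : ∀ v ∉ T, root v = v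

namespace IsParentForest

variable {V : Type*} {p : V → V} {T : Set V} {root : V → V} {rank : V → ℕ}

theorem adj_iff (h : IsParentForest p T root rank) {u w : V} :
    (parentGraph p T).Adj u w ↔ (u ∈ T ∧ p u = w) ∨ (w ∈ T ∧ p w = u) := by
  rw [parentGraph, fromRel_adj, and_iff_right_iff_imp]
  rintro (⟨hu, hp⟩ | ⟨hu, hp⟩) rfl <;> exact absurd (h.rank_lt _ hu) (by rw [hp]; exact lt_irrefl _)

theorem root_notMem (h : IsParentForest p T root rank) (v : V) : root v ∉ T := by
  induction hn : rank v using Nat.strong_induction_on generalizing v with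
  | _ n ih =>
    by_cases hv : v ∈ T
    · rw [h.root_of_mem v hv]
      exact ih _ (hn ▸ h.rank_lt v hv) _ rfl
    · rwa [h.root_of_notMem v hv]

theorem exists_iterate_eq_root (h : IsParentForest p T root rank) (v : V) :
    ∃ n, p^[n] v = root v := by
  induction hn : rank v using Nat.strong_induction_on generalizing v with
  | _ n ih =>
    by_cases hv : v ∈ T
    · obtain ⟨m, hm⟩ := ih _ (hn ▸ h.rank_lt v hv) (p v) rfl
      exact ⟨m + 1, by rw [iterate_succ_apply, hm, h.root_of_mem v hv]⟩
    · exact ⟨0, (h.root_of_notMem v hv).symm⟩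

theorem reachable_root (h : IsParentForest p T root rank) (v : V) :
    (parentGraph p T).Reachable v (root v) := by
  induction hn : rank v using Nat.strong_induction_on generalizing v with
  | _ n ih =>
    by_cases hv : v ∈ T
    · rw [h.root_of_mem v hv]
      exact (Adj.reachable (h.adj_iff.2 (.inl ⟨hv, rfl⟩))).trans
        (ih _ (hn ▸ h.rank_lt v hv) _ rfl)
    · rw [h.root_of_notMem v hv]

theorem reachable_iff (h : IsParentForest p T root rank) {u w : V} :
    (parentGraph p T).Reachable u w ↔ root u = root w := by
  refine ⟨fun hr => ?_, fun e => (h.reachable_root u).trans (e ▸ (h.reachable_root w).symm)⟩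
  obtain ⟨q⟩ := hr
  induction q with
  | nil => rfl
  | cons hadj _ ih =>
    rw [← ih]
    rcases h.adj_iff.1 hadj with ⟨hu, rfl⟩ | ⟨hu, rfl⟩
    · exact h.root_of_mem _ hu
    · exact (h.root_of_mem _ hu).symm

theorem isAcyclic (h : IsParentForest p T root rank) : (parentGraph p T).IsAcyclic := by
  classical
  intro v q hq
  obtain ⟨u, hu, hmax⟩ := Finset.exists_max_image q.support.toFinset rank
    ⟨v, by simp⟩
  simp only [List.mem_toFinset] at hu hmax
  -- At a vertex of the cycle of largest rank both cycle neighbours would be its parent.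
  have hq' := hq.rotate hu
  have hpar : ∀ x ∈ (q.rotate u hu).support, (parentGraph p T).Adj u x → x = p u := by
    intro x hx hux
    have hxr : rank x ≤ rank u := hmax x (by simpa using hx)
    rcases h.adj_iff.1 hux with ⟨-, rfl⟩ | ⟨hxT, rfl⟩
    · rfl
    · exact absurd (h.rank_lt x hxT) (by omega)
  refine hq'.snd_ne_penultimate ?_
  exact (hpar _ (Walk.getVert_mem_support _ _) (Walk.adj_snd hq'.not_nil)).trans
    (hpar _ (Walk.getVert_mem_support _ _) (Walk.adj_penultimate hq'.not_nil).symm).symm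

theorem neighborSet_eq (h : IsParentForest p T root rank) (v : V) :
    (parentGraph p T).neighborSet v = {c ∈ T | p c = v} ∪ {w | v ∈ T ∧ p v = w} := by
  ext w
  simp only [mem_neighborSet, h.adj_iff, Set.mem_union, Set.mem_ofPred_eq]
  exact or_comm

theorem encard_neighborSet_of_notMem (h : IsParentForest p T root rank) {k : ℕ∞} {v : V}
    (hk : {c ∈ T | p c = v}.encard = k) (hv : v ∉ T) :
    ((parentGraph p T).neighborSet v).encard = k := by
  rw [h.neighborSet_eq, ← hk]
  simp [hv]

theorem encard_neighborSet_of_mem (h : IsParentForest p T root rank) {k : ℕ∞} {v : V}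
    (hk : {c ∈ T | p c = v}.encard = k) (hv : v ∈ T) :
    ((parentGraph p T).neighborSet v).encard = k + 1 := by
  have hins : (parentGraph p T).neighborSet v = insert (p v) {c ∈ T | p c = v} := by
    rw [h.neighborSet_eq, Set.union_comm]
    ext w
    simp [hv, eq_comm]
  rw [hins, Set.encard_insert_of_notMem, hk]
  rintro ⟨hpT, hp⟩
  have h1 := h.rank_lt v hv
  have h2 := h.rank_lt _ hpT
  rw [hp] at h2
  omega

theorem isAryPseudoforest (h : IsParentForest p T root rank) {k : ℕ}
    (hk : ∀ v, {c ∈ T | p c = v}.encard = k) : (parentGraph p T).IsAryPseudoforest k := by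
  refine ⟨fun u v q _ _ hq _ => absurd hq (h.isAcyclic q), fun c => ⟨fun hac => ?_, fun hac => ?_⟩⟩
  · refine ⟨⟨c.connected_toSimpleGraph, hac⟩, ?_⟩
    have hnb : ∀ v : c, (c.toSimpleGraph.neighborSet v).encard =
        ((parentGraph p T).neighborSet v.1).encard := by
      intro v
      rw [← Subtype.val_injective.encard_image]
      congr 1
      ext w
      simp only [Set.mem_image, mem_neighborSet, Subtype.exists, exists_and_right, exists_eq_right]
      refine ⟨fun ⟨_, hw⟩ => hw, fun hw => ⟨?_, hw⟩⟩
      exact (ConnectedComponent.mem_supp_congr_adj c hw).1 v.2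
    obtain ⟨x, hx⟩ := c.nonempty_supp
    have hr : root x ∈ c.supp := by
      rw [ConnectedComponent.mem_supp_iff] at hx ⊢
      rw [← hx, ConnectedComponent.eq]
      exact (h.reachable_root x).symm
    refine ⟨⟨root x, hr⟩, ?_, fun v hv => ?_⟩
    · rw [hnb, h.encard_neighborSet_of_notMem (hk _) (h.root_notMem x)]
    · have hvT : v.1 ∈ T := by
        by_contra hvT
        apply hv
        ext
        have : (parentGraph p T).Reachable v.1 x := ConnectedComponent.exact (v.2.trans hx.symm)
        rw [h.reachable_iff, h.root_of_notMem _ hvT] at this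
        exact this
      rw [hnb, h.encard_neighborSet_of_mem (hk _) hvT]
      push_cast
      rfl
  · exact absurd (h.isAcyclic.induce c.supp) hac

theorem isComponentTransversal_compl (h : IsParentForest p T root rank) :
    (parentGraph p T).IsComponentTransversal Tᶜ := by
  intro c
  induction c using ConnectedComponent.ind with
  | _ x =>
    refine ⟨root x, ⟨h.root_notMem x, ConnectedComponent.sound (h.reachable_root x).symm⟩, ?_⟩
    rintro y ⟨hyT, hy⟩
    have := h.reachable_iff.1 (ConnectedComponent.exact hy)
    rwa [h.root_of_notMem y hyT] at this

end IsParentForest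

/-- A forest given by a parent map, with `k` children at every vertex, has all the required properties
once every edge of `G` inside a tree or between two vertices that are not roots belongs to it. -/
theorem exists_aryPseudoforest_of_isParentForest {V : Type*} {G : SimpleGraph V} {p : V → V}
    {T : Set V} {root : V → V} {rank : V → ℕ} (h : IsParentForest p T root rank) {k : ℕ}
    (hk : ∀ v, {c ∈ T | p c = v}.encard = k) (hle : ∀ v ∈ T, G.Adj v (p v))
    (hroot : ∀ u w, G.Adj u w → root u = root w → (parentGraph p T).Adj u w)
    (hT : ∀ u ∈ T, ∀ w ∈ T, G.Adj u w → (parentGraph p T).Adj u w) :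
    ∃ F : SimpleGraph V, F ≤ G ∧ F.IsAryPseudoforest k ∧ F.IsComponentwiseInduced G ∧
      ∃ S : Set V, F.IsComponentTransversal S ∧ F.induce Sᶜ = G.induce Sᶜ ∧
        (F.induce Sᶜ).IsAcyclic := by
  have hFG : parentGraph p T ≤ G := by
    intro u w huw
    rcases h.adj_iff.1 huw with ⟨hu, rfl⟩ | ⟨hu, rfl⟩
    · exact hle _ hu
    · exact (hle _ hu).symm
  refine ⟨parentGraph p T, hFG, h.isAryPseudoforest hk, fun c => ?_, Tᶜ,
    h.isComponentTransversal_compl, ?_, h.isAcyclic.induce _⟩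
  · ext u w
    refine ⟨fun e => hFG e, fun e => hroot _ _ e ?_⟩
    exact h.reachable_iff.1 (ConnectedComponent.exact (u.2.trans w.2.symm))
  · ext u w
    exact ⟨fun e => hFG e, fun e => hT _ (not_not.1 u.2) _ (not_not.1 w.2) e⟩

/-! ### Parents and balanced edges -/

/-- If `rank` decreases along `p` outside `B`, a forest can be built from the roots downwards: a vertex
`v ∉ B` is attached to its parent `p v` if and only if `R v s` holds for the root `s` of the tree of
`p v`, which is already known at that moment. -/
theorem exists_root_of_attachment {V : Type*} (p : V → V) (B : Set V) (rank : V → ℕ)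
    (hr : ∀ v ∉ B, rank (p v) < rank v) (R : V → V → Prop) :
    ∃ root : V → V, IsParentForest p {v | v ∉ B ∧ R v (root (p v))} root rank := by
  classical
  let step : ∀ v : V, (∀ w : V, rank w < rank v → V) → V := fun v ih =>
    if h : v ∉ B then (if R v (ih (p v) (hr v h)) then ih (p v) (hr v h) else v) else v
  let root : V → V := (measure rank).wf.fix step
  have hfix : ∀ v, root v = if v ∉ B ∧ R v (root (p v)) then root (p v) else v := by
    intro v
    refine ((measure rank).wf.fix_eq step v).trans ?_
    change (if h : v ∉ B then (if R v (root (p v)) then root (p v) else v) else v) = _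
    by_cases h : v ∉ B <;> simp [h]
  refine ⟨root, fun v hv => hr v hv.1, fun v hv => ?_, fun v hv => ?_⟩
  · exact (hfix v).trans (if_pos ⟨hv.1, hv.2⟩)
  · exact (hfix v).trans (if_neg fun hc => hv hc)

/-- A decomposition of the edges of `G` into edges from a vertex `v` to its parent `p v` and balanced
edges, those between vertices related by `Q`. A vertex without a parent is encoded as a fixed point
of `p`, and a vertex with a parent is in at most one balanced edge. -/
structure IsParentDecomposition {V : Type*} (G : SimpleGraph V) (p : V → V) (Q : V → V → Prop) :
    Prop where
  adj_parent : ∀ v, p v ≠ v → G.Adj v (p v)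
  symm : ∀ v w, Q v w → Q w v
  irrefl : ∀ v, ¬ Q v v
  cover : ∀ v w, G.Adj v w → p v = w ∨ p w = v ∨ Q v w
  unique : ∀ v, p v ≠ v → ∀ w w', Q v w → Q v w' → w = w'

/-- From a distribution of tokens: the parent of `v` is the vertex `w` with `t v w = 2`, and balanced
edges are those with `t v w = 1`. The children of `v` are the neighbors `w` with `t v w = 0`, and all
but at most three neighbors are of this kind. -/
theorem exists_parentDecomposition {V : Type*} (G : SimpleGraph V) [G.LocallyFinite] (d : ℕ)
    (hd : G.IsRegularOfDegree d) (t : V → V → ℕ)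
    (ht : ∀ v w, G.Adj v w → t v w + t w v = 2) (hsum : ∀ v, ∑ w ∈ G.neighborFinset v, t v w ≤ 3) :
    ∃ (p : V → V) (Q : V → V → Prop), G.IsParentDecomposition p Q ∧
      (∀ v, {w | Q v w}.encard ≤ 3) ∧
      ∀ v, ∃ C : Finset V, (∀ c ∈ C, p c = v ∧ c ≠ v) ∧ d ≤ #C + 3 := by
  classical
  have hp : ∀ v, ∃ w, (G.Adj v w ∧ t v w = 2) ∨ (w = v ∧ ∀ u, G.Adj v u → t v u ≠ 2) := by
    intro v
    by_cases h : ∃ w, G.Adj v w ∧ t v w = 2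
    · exact h.imp fun w hw => .inl hw
    · push Not at h
      exact ⟨v, .inr ⟨rfl, h⟩⟩
  choose p hp using hp
  have htwo : ∀ v u w, G.Adj v u → G.Adj v w → u ≠ w → t v u + t v w ≤ 3 := by
    intro v u w hu hw huw
    rw [← Finset.sum_pair huw (f := fun x => t v x)]
    refine le_trans (Finset.sum_le_sum_of_subset ?_) (hsum v)
    intro x hx
    simp only [Finset.mem_insert, Finset.mem_singleton] at hx
    rcases hx with rfl | rfl <;> simpa
  have hcard : ∀ v, #((G.neighborFinset v).filter fun w => t v w ≠ 0) ≤ 3 := by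
    intro v
    refine le_trans ?_ ((Finset.sum_le_sum_of_subset (Finset.filter_subset (fun w => t v w ≠ 0) _)).trans (hsum v))
    rw [Finset.card_eq_sum_ones]
    exact Finset.sum_le_sum fun w hw => Nat.one_le_iff_ne_zero.2 (Finset.mem_filter.1 hw).2
  have huniq : ∀ v w, G.Adj v w → t v w = 2 → p v = w := by
    intro v w hvw h2
    rcases hp v with ⟨ha, h2'⟩ | ⟨-, h⟩
    · by_contra hne
      have := htwo v _ _ ha hvw hne
      omega
    · exact absurd h2 (h w hvw)
  refine ⟨p, fun v w => G.Adj v w ∧ t v w = 1, ⟨?_, ?_, ?_, ?_, ?_⟩, ?_, ?_⟩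
  · intro v hv
    exact ((hp v).resolve_right fun h => hv h.1).1
  · rintro v w ⟨h, h1⟩
    have := ht v w h
    exact ⟨h.symm, by omega⟩
  · exact fun v h => h.1.ne rfl
  · intro v w h
    have := ht v w h
    rcases (by omega : t v w = 2 ∨ t w v = 2 ∨ t v w = 1) with h2 | h2 | h2
    · exact .inl (huniq v w h h2)
    · exact .inr (.inl (huniq w v h.symm h2))
    · exact .inr (.inr ⟨h, h2⟩)
  · rintro v hv w w' ⟨h, h1⟩ ⟨h', h1'⟩
    obtain ⟨ha, h2⟩ := (hp v).resolve_right fun h => hv h.1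
    by_contra hne
    have hw : p v ≠ w := fun e => by rw [e] at h2; omega
    have hw' : p v ≠ w' := fun e => by rw [e] at h2; omega
    have hs := (Finset.sum_le_sum_of_subset (f := fun x => t v x)
      (s := {p v, w, w'}) (t := G.neighborFinset v) (by
        intro x hx
        simp only [Finset.mem_insert, Finset.mem_singleton] at hx
        rcases hx with rfl | rfl | rfl <;> simpa)).trans (hsum v)
    rw [Finset.sum_insert (by simp [hw, hw']), Finset.sum_pair hne] at hs
    omega
  · intro v
    have hsub : {w | G.Adj v w ∧ t v w = 1} ⊆
        ((G.neighborFinset v).filter fun w => t v w ≠ 0 : Finset V) := by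
      rintro w ⟨h, h1⟩
      simp [h, h1]
    refine (Set.encard_le_encard hsub).trans ?_
    rw [Set.encard_coe_eq_coe_finsetCard]
    exact_mod_cast hcard v
  · intro v
    refine ⟨(G.neighborFinset v).filter fun w => t v w = 0, fun c hc => ?_, ?_⟩
    · simp only [Finset.mem_filter, mem_neighborFinset] at hc
      have := ht v c hc.1
      exact ⟨huniq c v hc.1.symm (by omega), hc.1.ne'⟩
    · have h1 := Finset.card_filter_add_card_filter_not (s := G.neighborFinset v)
        (fun w => t v w = 0)
      rw [card_neighborFinset_eq_degree, hd.degree_eq] at h1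
      have := hcard v
      simp only [ne_eq] at this
      omega

/-- If each vertex has at least `2k` children, one can choose `k` children of each vertex such that no
balanced edge joins two chosen vertices. -/
theorem IsParentDecomposition.exists_independent_children {V : Type*} {G : SimpleGraph V}
    {p : V → V} {Q : V → V → Prop} (h : G.IsParentDecomposition p Q) {k : ℕ}
    (hC : ∀ v, ∃ C : Finset V, (∀ c ∈ C, p c = v ∧ c ≠ v) ∧ 2 * k ≤ #C) :
    ∃ C : V → Finset V, (∀ v, #(C v) = k) ∧ (∀ v, ∀ c ∈ C v, p c = v ∧ c ≠ v) ∧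
      ∀ v w, ∀ c ∈ C v, ∀ c' ∈ C w, ¬ Q c c' := by
  classical
  choose D hD hDcard using hC
  -- `item v` is the balanced edge from `v` to another vertex with a parent, or `s(v, v)` if there is
  -- none. Distinct items for the chosen children exclude a balanced edge between two of them.
  have hitem : ∀ v, ∃ e : Sym2 V, v ∈ e ∧ (p v ≠ v → ∀ w, p w ≠ w → Q v w → e = s(v, w)) := by
    intro v
    by_cases hw : ∃ w, p w ≠ w ∧ Q v w
    · obtain ⟨w, -, hvw⟩ := hw
      exact ⟨s(v, w), Sym2.mem_mk_left v w, fun hv w' _ hvw' => by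
        rw [h.unique v hv w w' hvw hvw']⟩
    · exact ⟨s(v, v), Sym2.mem_mk_left v v, fun _ w hpw hvw => absurd ⟨w, hpw, hvw⟩ hw⟩
  choose item hmem hitem using hitem
  obtain ⟨f, hf, hfmem⟩ := (Finset.all_card_le_biUnion_card_iff_exists_injective
    (fun x : V × Fin k => (D x.1).image item)).1 (by
      intro s
      set P := s.image Prod.fst with hP
      have h1 : #s ≤ #P * k := by
        have hsub : s ⊆ P ×ˢ (univ : Finset (Fin k)) := fun x hx =>
          Finset.mem_product.2 ⟨Finset.mem_image_of_mem _ hx, Finset.mem_univ _⟩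
        simpa using Finset.card_le_card hsub
      have h2 : #P * (2 * k) ≤ #(P.biUnion D) := by
        rw [Finset.card_biUnion, ← smul_eq_mul]
        · exact Finset.card_nsmul_le_sum _ _ _ fun v _ => hDcard v
        · intro v _ w _ hvw
          refine Finset.disjoint_left.2 ?_
          exact fun c hc hc' => hvw ((hD v c hc).1.symm.trans (hD w c hc').1)
      -- An item has at most two endpoints, so at most two children share it.
      have h3 : #(P.biUnion D) ≤ 2 * #((P.biUnion D).image item) := by
        refine Finset.card_le_mul_card_image _ _ fun e _ => ?_
        have hsub : (P.biUnion D).filter (fun a => item a = e) ⊆ e.toFinset := by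
          intro a ha
          rw [Sym2.mem_toFinset, ← (Finset.mem_filter.1 ha).2]
          exact hmem a
        refine (Finset.card_le_card hsub).trans ?_
        rw [Sym2.card_toFinset]
        split_ifs <;> omega
      have h4 : (P.biUnion D).image item = s.biUnion fun x => (D x.1).image item := by
        rw [hP, Finset.image_biUnion, Finset.biUnion_image]
      rw [← h4]
      nlinarith)
  have hc : ∀ v i, ∃ c ∈ D v, item c = f (v, i) := fun v i => Finset.mem_image.1 (hfmem (v, i))
  choose c hcD hcf using hc
  have hinj : ∀ v i w j, item (c v i) = item (c w j) → (v, i) = (w, j) := by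
    intro v i w j e
    rw [hcf, hcf] at e
    exact hf e
  refine ⟨fun v => univ.image (c v), fun v => ?_, fun v x hx => ?_, fun v w x hx y hy hxy => ?_⟩
  · rw [Finset.card_image_of_injective, Finset.card_univ, Fintype.card_fin]
    intro i j e
    exact (Prod.mk.inj (hinj v i v j (congrArg item e))).2
  · obtain ⟨i, -, rfl⟩ := Finset.mem_image.1 hx
    exact hD v _ (hcD v i)
  · obtain ⟨i, -, rfl⟩ := Finset.mem_image.1 hx
    obtain ⟨j, -, rfl⟩ := Finset.mem_image.1 hy
    have hv : p (c v i) ≠ c v i := by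
      rw [(hD v _ (hcD v i)).1]
      exact (hD v _ (hcD v i)).2.symm
    have hw : p (c w j) ≠ c w j := by
      rw [(hD w _ (hcD w j)).1]
      exact (hD w _ (hcD w j)).2.symm
    have e : item (c v i) = item (c w j) := by
      rw [hitem _ hv _ hw hxy, hitem _ hw _ hv (h.symm _ _ hxy), Sym2.eq_swap]
    have := hinj _ _ _ _ e
    simp only [Prod.mk.injEq] at this
    obtain ⟨rfl, rfl⟩ := this
    exact h.irrefl _ hxy

/-! ### Selecting the children -/

theorem IsParentDecomposition.exists_aryPseudoforest {V : Type*} {G : SimpleGraph V}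
    {p : V → V} {Q : V → V → Prop} (h : G.IsParentDecomposition p Q) {k : ℕ}
    (hQ : ∀ v, {w | Q v w}.encard ≤ 3)
    (hC : ∀ v, ∃ C : Finset V, (∀ c ∈ C, p c = v ∧ c ≠ v) ∧ 2 * (k + 4) ≤ #C) :
    ∃ F : SimpleGraph V, F ≤ G ∧ F.IsAryPseudoforest k ∧ F.IsComponentwiseInduced G ∧
      ∃ S : Set V, F.IsComponentTransversal S ∧ F.induce Sᶜ = G.induce Sᶜ ∧
        (F.induce Sᶜ).IsAcyclic := by
  classical
  obtain ⟨C, hCcard, hCp, hCQ⟩ := h.exists_independent_children hC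
  obtain ⟨B, hBinj, hBhit, hBper⟩ := Function.exists_backbone p
  have hrank : ∀ v ∉ B, Nat.find (hBhit (p v)) < Nat.find (hBhit v) := by
    intro v hv
    obtain ⟨n, hn⟩ : ∃ n, Nat.find (hBhit v) = n + 1 := by
      refine Nat.exists_eq_succ_of_ne_zero fun h0 => hv ?_
      simpa [h0] using Nat.find_spec (hBhit v)
    have hs := Nat.find_spec (hBhit v)
    rw [hn, iterate_succ_apply] at hs
    have := Nat.find_min' (hBhit (p v)) hs
    omega
  -- `K v s` is the set of children that `v` selects if it lies in the tree with root `s`.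
  have hsel : ∀ v s, ∃ K : Finset V, K ⊆ (C v).filter (fun c => c ∉ B ∧ ¬ Q s c) ∧ #K = k := by
    intro v s
    refine Finset.exists_subset_card_eq ?_
    have h1 : #((C v).filter fun c => c ∈ B) ≤ 1 := by
      refine Finset.card_le_one.2 fun a ha b hb => ?_
      rw [Finset.mem_filter] at ha hb
      exact hBinj ha.2 hb.2 ((hCp v a ha.1).1.trans (hCp v b hb.1).1.symm)
    have h2 : #((C v).filter fun c => Q s c) ≤ 3 := by
      have hsub : (((C v).filter fun c => Q s c : Finset V) : Set V) ⊆ {w | Q s w} := by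
        intro c hc
        exact (Finset.mem_filter.1 hc).2
      have := (Set.encard_le_encard hsub).trans (hQ s)
      rw [Set.encard_coe_eq_coe_finsetCard] at this
      exact_mod_cast this
    have h3 : C v ⊆ (C v).filter (fun c => c ∉ B ∧ ¬ Q s c) ∪
        ((C v).filter (fun c => c ∈ B) ∪ (C v).filter fun c => Q s c) := by
      intro c hc
      simp only [Finset.mem_union, Finset.mem_filter, hc, true_and]
      tauto
    have h4 := Finset.card_le_card h3
    have h5 := Finset.card_union_le ((C v).filter (fun c => c ∉ B ∧ ¬ Q s c))
      ((C v).filter (fun c => c ∈ B) ∪ (C v).filter fun c => Q s c)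
    have h6 := Finset.card_union_le ((C v).filter (fun c => c ∈ B)) ((C v).filter fun c => Q s c)
    rw [hCcard v] at h4
    omega
  choose K hK hKcard using hsel
  have hK' : ∀ v s c, c ∈ K v s → c ∈ C v ∧ c ∉ B ∧ ¬ Q s c := fun v s c hc =>
    Finset.mem_filter.1 (hK v s hc)
  obtain ⟨root, hF⟩ := exists_root_of_attachment p B (fun v => Nat.find (hBhit v)) hrank
    (fun v s => v ∈ K (p v) s)
  set T : Set V := {v | v ∉ B ∧ v ∈ K (p v) (root (p v))} with hTdef
  have hTC : ∀ v ∈ T, v ∈ C (p v) := fun v hv => (hK' _ _ _ hv.2).1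
  have hTQ : ∀ v ∈ T, ∀ w ∈ T, ¬ Q v w := fun v hv w hw => hCQ _ _ v (hTC v hv) w (hTC w hw)
  -- Two vertices of one tree are never joined by a parent edge that is not in the forest,
  -- because such an edge would close a cycle of `p`, and those lie in `B`.
  have hpar : ∀ u, p u ≠ u → root u = root (p u) → u ∈ T := by
    intro u hne he
    by_contra hu
    rw [hF.root_of_notMem u hu] at he
    by_cases hpu : p u ∈ T
    · obtain ⟨n, hn⟩ := hF.exists_iterate_eq_root (p u)
      have hper : u ∈ periodicPts p :=
        ⟨n + 1, n.succ_pos, by rw [IsPeriodicPt, IsFixedPt, iterate_succ_apply, hn, ← he]⟩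
      exact hpu.1 (hBper _ ((bijOn_periodicPts p).mapsTo hper))
    · rw [hF.root_of_notMem _ hpu] at he
      exact hne he.symm
  have hrootQ : ∀ u, u ∉ T → ∀ w ∈ T, root u = root w → ¬ Q u w := by
    intro u hu w hw he
    rw [hF.root_of_notMem u hu, hF.root_of_mem w hw] at he
    rw [he]
    exact (hK' _ _ _ hw.2).2.2
  refine exists_aryPseudoforest_of_isParentForest hF (fun v => ?_) (fun v hv => ?_)
    (fun u w huw he => ?_) (fun u hu w hw huw => ?_)
  · have : {c ∈ T | p c = v} = (K v (root v) : Set V) := by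
      ext c
      simp only [hTdef, Set.mem_ofPred_eq, Finset.mem_coe]
      constructor
      · rintro ⟨⟨-, hc⟩, rfl⟩
        exact hc
      · intro hc
        obtain ⟨hcC, hcB, -⟩ := hK' _ _ _ hc
        obtain rfl := (hCp _ _ hcC).1
        exact ⟨⟨hcB, hc⟩, rfl⟩
    rw [this, Set.encard_coe_eq_coe_finsetCard, hKcard]
  · exact h.adj_parent v (hCp _ _ (hTC v hv)).2.symm
  · rw [hF.adj_iff]
    rcases h.cover u w huw with rfl | rfl | hq
    · exact .inl ⟨hpar u huw.ne' he, rfl⟩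
    · exact .inr ⟨hpar w huw.ne he.symm, rfl⟩
    · exfalso
      by_cases hu : u ∈ T <;> by_cases hw : w ∈ T
      · exact hTQ u hu w hw hq
      · exact hrootQ w hw u hu he.symm (h.symm _ _ hq)
      · exact hrootQ u hu w hw he hq
      · rw [hF.root_of_notMem u hu, hF.root_of_notMem w hw] at he
        exact huw.ne he
  · rw [hF.adj_iff]
    rcases h.cover u w huw with rfl | rfl | hq
    · exact .inl ⟨hu, rfl⟩
    · exact .inr ⟨hw, rfl⟩
    · exact absurd hq (hTQ u hu w hw)

end SimpleGraph

theorem mainTheorem5 :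
    ∃ ε : ℝ, 0 < ε ∧
      ∀ (V : Type*) [Countable V] (G : SimpleGraph V) [G.LocallyFinite] (d Δ : ℕ),
        G.IsRegularOfDegree d →
        (Δ : ℝ) < ε * (d : ℝ) →
        (((d : ℝ) - 3 + 1 / ((10 : ℝ) ^ 7 * (Δ : ℝ) + 1) : ℝ) : EReal) < (G.edgeCheeger : EReal) →
        ∃ F : SimpleGraph V, F ≤ G ∧
          F.IsAryPseudoforest Δ ∧
          F.IsComponentwiseInduced G ∧
          ∃ S : Set V, F.IsComponentTransversal S ∧
            F.induce Sᶜ = G.induce Sᶜ ∧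
            (F.induce Sᶜ).IsAcyclic := by
  -- For `Δ ≥ 1`, the inequality `13 * Δ < d` gives `2 * (Δ + 4) + 3 ≤ d`, where `3` bounds the number
  -- of neighbors of a vertex that are not its children.
  refine ⟨1 / 13, by norm_num, fun V _ G _ d Δ hd hΔ hh => ?_⟩
  rcases Nat.eq_zero_or_pos Δ with rfl | hpos
  · exact SimpleGraph.exists_aryPseudoforest_of_isParentForest (p := id) (T := ∅) (root := id)
      (rank := fun _ => 0) ⟨by simp, by simp, by simp⟩ (by simp) (by simp)
      (fun u w huw he => absurd he huw.ne) (by simp)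
  · have hlt : 13 * Δ < d := by
      have : (13 * Δ : ℝ) < d := by linarith
      exact_mod_cast this
    have hh' : (((d : ℝ) - 3 : ℝ) : EReal) < (G.edgeCheeger : EReal) := by
      refine lt_of_le_of_lt (EReal.coe_le_coe_iff.2 ?_) hh
      have : (0 : ℝ) ≤ 1 / ((10 : ℝ) ^ 7 * (Δ : ℝ) + 1) := by positivity
      linarith
    obtain ⟨t, ht, hsum⟩ := G.exists_half_orientation fun A hA X hX =>
      G.two_mul_card_le_three_mul_card hd hh' A hA X hX
    obtain ⟨p, Q, hpQ, hQ, hC⟩ := G.exists_parentDecomposition d hd t ht hsum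
    refine hpQ.exists_aryPseudoforest hQ fun v => ?_
    obtain ⟨C, hCp, hCcard⟩ := hC v
    exact ⟨C, hCp, by omega⟩
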